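/- An arena is a countable directed graph $(V,E)$ in which every vertex has an outgoing edge, with a partition of $V$ into vertices $V_E$ of Eve and $V_A$ of Adam. A play from $v_0$ is formed by letting the owner of the current vertex choose an outgoing edge at each step. A strategy of a player maps each finite history ending in one of the player's vertices to a successor of that vertex; Eve's strategy $\sigma$ is winning from $U\subseteq V$ for a set $\Omega$ of infinite plays if, for every $v_0\in U$ and every strategy of Adam, the resulting play is in $\Omega$. Eve's winning set is the set of vertices $v$ such that Eve has a winning strategy from $\{v\}$. A memory structure consists of a set $M$ of memory states, an initial state $m_0\in M$ and an update function $\mu:M\times E\to M$, applied to each edge taken; a strategy relies on it if its moves are a function of the current vertex and the current memory state, and it is memoryless if its moves are a function of the current vertex only. For $F\subseteq V$ and a play $\pi=\pi_0\pi_1\cdots$ let $\mathrm{dist}_k(\pi,F)=\inf\{k'-k : k'\ge k,\ \pi_{k'}\in F\}$, and for a colouring $c:V\to\{0,\dots,d\}$ let $\mathrm{dist}_k(\pi,c)=\inf\{k'-k : k'\ge k,\ c(\pi_{k'})\text{ is even},\ c(\pi_{k'})\le c(\pi_k)\}$, where $\inf\emptyset=\infty$. The finitary Büchi condition is $\{\pi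 : \limsup_k \mathrm{dist}_k(\pi,F)<\infty\}$ and the finitary parity condition is $\{\pi : \limsup_k \mathrm{dist}_k(\pi,c)<\infty\}$. **Theorem (Strategy complexity for finitary games).** For every arena the following hold. 1. For every $F\subseteq V$, Eve has a memoryless strategy that is winning from her whole winning set for the finitary Büchi condition of $F$. 2. For every $d\in\mathbb N$ and every $c:V\to\{0,\dots,d\}$, Eve has a strategy that is winning from her whole winning set for the finitary parity condition of $c$ and that relies on a memory structure with at most $\ell+1$ memory states, where $\ell$ is the number of odd colours in $\{0,\dots,d\}$. -/

import Mathlib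

namespace FinitaryGames

/-- An arena on the vertex set `V`: the edge relation of a graph without dead ends, and the set of
vertices controlled by Eve. The vertices outside `eve` are controlled by Adam. -/
structure Arena (V : Type*) where
  eve : Set V
  Edge : V → V → Prop
  no_dead_end : ∀ v, ∃ v', Edge v v'

/-- The vertices controlled by Adam. -/
def Arena.adam {V : Type*} (A : Arena V) : Set V := A.eveᶜ

/-- A strategy for the player who controls the vertices of `S`: given the past `w` of the play
and the current vertex `v ∈ S`, it picks a successor of `v`. The list `w` holds the vertices
visited strictly before `v`, the most recent one first. -/
structure Strategy {V : Type*} (A : Arena V) (S : Set V) where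
  move : List V → S → V
  legal : ∀ (w : List V) (v : S), A.Edge v (move w v)

/-- Strategies for Eve. -/
abbrev EveStrategy {V : Type*} (A : Arena V) := Strategy A A.eve

/-- Strategies for Adam. -/
abbrev AdamStrategy {V : Type*} (A : Arena V) := Strategy A A.adam

open Classical in
/-- The vertex that follows the past `w` and the current vertex `v`. -/
noncomputable def next {V : Type*} {A : Arena V} (σ : EveStrategy A) (τ : AdamStrategy A)
    (w : List V) (v : V) : V :=
  if h : v ∈ A.eve then σ.move w ⟨v, h⟩ else τ.move w ⟨v, h⟩

/-- The past (most recent vertex first) and the current vertex after `n` steps, from `v₀`. -/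
noncomputable def position {V : Type*} {A : Arena V} (v₀ : V) (σ : EveStrategy A)
    (τ : AdamStrategy A) : ℕ → List V × V
  | 0 => ([], v₀)
  | n + 1 =>
    ((position v₀ σ τ n).2 :: (position v₀ σ τ n).1,
      next σ τ (position v₀ σ τ n).1 (position v₀ σ τ n).2)

/-- The play that results from the two strategies, starting from `v₀`. -/
noncomputable def play {V : Type*} {A : Arena V} (v₀ : V) (σ : EveStrategy A)
    (τ : AdamStrategy A) (n : ℕ) : V :=
  (position v₀ σ τ n).2

/-- `σ` is a winning strategy for Eve from the set `U` for the condition `Ω`. -/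
def EveStrategy.WinsFrom {V : Type*} {A : Arena V} (σ : EveStrategy A) (Ω : Set (ℕ → V))
    (U : Set V) : Prop :=
  ∀ v₀ ∈ U, ∀ τ : AdamStrategy A, play v₀ σ τ ∈ Ω

/-- Eve's winning set: the vertices from which Eve has a winning strategy. -/
def eveWinningSet {V : Type*} (A : Arena V) (Ω : Set (ℕ → V)) : Set V :=
  {v | ∃ σ : EveStrategy A, EveStrategy.WinsFrom σ Ω {v}}

/-- A memory structure with set of states `M`. The memory is updated along each edge `(u, v)`
taken (the values of `update` on pairs that are not edges play no role). -/
structure MemoryStructure (V M : Type*) where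
  init : M
  update : M → V → V → M

/-- The memory state reached once the vertices of `w` (most recent first), and then `v`,
have been visited. -/
def MemoryStructure.state {V M : Type*} (𝓜 : MemoryStructure V M) : List V → V → M
  | [], _ => 𝓜.init
  | u :: w, v => 𝓜.update (𝓜.state w u) u v

/-- `σ` relies on the memory structure `𝓜`: its moves are given by a next-move function of the
current vertex and the current memory state. -/
def EveStrategy.Uses {V M : Type*} {A : Arena V} (σ : EveStrategy A)
    (𝓜 : MemoryStructure V M) : Prop :=
  ∃ ν : A.eve → M → V, ∀ (w : List V) (v : A.eve), σ.move w v = ν v (𝓜.state w v)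

/-- `σ` is memoryless: its moves depend only on the current vertex. -/
def EveStrategy.Memoryless {V : Type*} {A : Arena V} (σ : EveStrategy A) : Prop :=
  ∃ ν : A.eve → V, ∀ (w : List V) (v : A.eve), σ.move w v = ν v

/-- The number of steps from the `k`-th vertex of the play to the next vertex of `F`
(`⊤` if there is none). -/
noncomputable def distBuchi {V : Type*} (F : Set V) (π : ℕ → V) (k : ℕ) : ℕ∞ :=
  ⨅ (k' : ℕ) (_ : k ≤ k' ∧ π k' ∈ F), ((k' - k : ℕ) : ℕ∞)

/-- The finitary Büchi condition. -/
def FinBuchi {V : Type*} (F : Set V) : Set (ℕ → V) :=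
  {π | Filter.limsup (distBuchi F π) Filter.atTop < ⊤}

/-- The number of steps from the `k`-th vertex of the play to the next vertex whose colour is even
and not larger than that of the `k`-th vertex (`⊤` if there is none). -/
noncomputable def distParity {V : Type*} {d : ℕ} (c : V → Fin (d + 1)) (π : ℕ → V) (k : ℕ) : ℕ∞ :=
  ⨅ (k' : ℕ) (_ : k ≤ k' ∧ Even (c (π k') : ℕ) ∧ c (π k') ≤ c (π k)), ((k' - k : ℕ) : ℕ∞)

/-- The finitary parity condition. -/
def FinParity {V : Type*} {d : ℕ} (c : V → Fin (d + 1)) : Set (ℕ → V) :=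
  {π | Filter.limsup (distParity c π) Filter.atTop < ⊤}

/-- The number of odd colours in `{0, …, d}`. -/
def numOddColours (d : ℕ) : ℕ := ((Finset.range (d + 1)).filter fun i => Odd i).card

end FinitaryGames

/-!
Both conditions ask that, from some point on, every visit to a vertex `v` is answered by a visit to
a set `T v` within a bounded number of steps. Call a set `D` a layer on top of `X` if, as long as
the play does not enter `X`, Eve can keep it in `D` and force the answer to every vertex of `D`
within a uniform number of steps. Stack layers transfinitely until no further one fits on top of
their union `X`.

Eve loses outside `X`. Adam can keep the play outside `X`, and such plays are parametrised
continuously by his choices. Against a winning strategy, the Baire category theorem yields a finite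
history after which the bound on the response time is uniform, and the vertices visited after it
would form a further layer.

In `X`, Eve follows the attractor strategy of the current layer for the smallest open request. A
play moves down the well-founded order of the layers only finitely often, so she may forget the
requests whenever it does, and in the last layer each request is answered after boundedly many
steps. The smallest open request is an odd colour or absent, and with the colours `0` and `1` it is
determined by the current vertex.
-/

namespace FinitaryGames

open Set

universe u

variable {V : Type u}

/-! ### Forcing a visit -/

/-- The controlled predecessor: the vertices from which Eve can make sure that the next vertex is
in `S`. -/
def Arena.cpre (A : Arena V) (S : Set V) : Set V :=
  {v | (v ∈ A.eve → ∃ u, A.Edge v u ∧ u ∈ S) ∧ (v ∈ A.adam → ∀ u, A.Edge v u → u ∈ S)}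

/-- The bounded attractor: the vertices from which Eve can make sure that within `n` steps the play
visits `T` or enters `X`, remaining in `D` until then. -/
def Arena.attr (A : Arena V) (X D T : Set V) : ℕ → Set V
  | 0 => T
  | n + 1 => T ∪ A.cpre (X ∪ D ∩ A.attr X D T n)

/-- The move from `v` to `u` remains in `X ∪ D` and, unless it enters `X` or `T` is visited already,
decreases the number of steps within which Eve can force a visit to `T`. -/
def Arena.Advances (A : Arena V) (X D T : Set V) (v u : V) : Prop :=
  u ∈ X ∪ D ∧ (v ∉ T → ∀ n, v ∈ A.attr X D T (n + 1) → u ∈ X ∪ A.attr X D T n)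

section Attractor

variable {A : Arena V} {X D S S' T : Set V}

theorem cpre_mono (h : S ⊆ S') : A.cpre S ⊆ A.cpre S' := fun _ hv =>
  ⟨fun he => (hv.1 he).imp fun _ hu => ⟨hu.1, h hu.2⟩, fun ha u hu => h (hv.2 ha u hu)⟩

theorem attr_mono : Monotone (A.attr X D T) := by
  refine monotone_nat_of_le_succ fun n => ?_
  induction n with
  | zero => exact subset_union_left
  | succ n ih => exact union_subset_union_right _ (cpre_mono (by gcongr))

theorem mem_cpre_advances {v : V} (hv : v ∈ A.cpre (X ∪ D)) :
    v ∈ A.cpre {u | A.Advances X D T v u} := by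
  classical
  refine ⟨fun he => ?_, fun ha u hu => ⟨hv.2 ha u hu, fun hvT n hn => ?_⟩⟩
  · by_cases hex : v ∉ T ∧ ∃ n, v ∈ A.attr X D T (n + 1)
    · obtain ⟨hvT, hex⟩ := hex
      have hleast := (Nat.find_spec hex).resolve_left hvT
      obtain ⟨u, hvu, hu⟩ := hleast.1 he
      exact ⟨u, hvu, union_subset_union_right X inter_subset_left hu, fun _ n hn =>
        union_subset_union_right X
          (inter_subset_right.trans (attr_mono (Nat.find_min' hex hn))) hu⟩
    · obtain ⟨u, hvu, hu⟩ := hv.1 he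
      exact ⟨u, hvu, hu, fun hvT n hn => absurd ⟨hvT, n, hn⟩ hex⟩
  · exact union_subset_union_right X inter_subset_right ((hn.resolve_left hvT).2 ha u hu)

end Attractor

/-! ### Layers -/

/-- A layer on top of `X`: Eve can keep the play in `D` unless it enters `X`, and from every vertex
`v` of `D` she can force a visit to `T v` within a uniform number of steps, unless the play enters
`X`. -/
def IsLayer (A : Arena V) (T : V → Set V) (X D : Set V) : Prop :=
  D ⊆ A.cpre (X ∪ D) ∧ ∃ N, ∀ v ∈ D, v ∈ A.attr X D (T v) N

theorem isLayer_singleton {A : Arena V} {T : V → Set V} {X : Set V} {v : V} (hv : v ∈ A.cpre X) :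
    IsLayer A T X {v} := by
  refine ⟨?_, 1, ?_⟩
  · rintro _ rfl
    exact cpre_mono subset_union_left hv
  · rintro _ rfl
    exact Or.inr (cpre_mono subset_union_left hv)

theorem mem_transfiniteIterate_empty_iff {φ : Set V → Set V} (hφ : ∀ X, X ⊆ φ X) {v : V}
    {γ : Ordinal.{u}} :
    v ∈ transfiniteIterate φ γ ∅ ↔ ∃ β < γ, v ∈ transfiniteIterate φ (Order.succ β) ∅ := by
  have hmono := monotone_transfiniteIterate (J := Ordinal.{u}) φ ∅ hφ
  refine ⟨fun hv => ?_, fun ⟨β, hβ, hv⟩ => hmono (Order.succ_le_of_lt hβ) hv⟩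
  induction γ using SuccOrder.limitRecOn with
  | isMin γ hγ =>
    obtain rfl := hγ.eq_bot
    rw [transfiniteIterate_bot] at hv
    exact hv.elim
  | succ γ _ _ => exact ⟨γ, Order.lt_succ γ, hv⟩
  | isSuccLimit γ hγ ih =>
    rw [transfiniteIterate_limit _ _ _ hγ] at hv
    obtain ⟨⟨β, hβ⟩, hv⟩ := mem_iUnion.1 hv
    obtain ⟨β', hβ', hv⟩ := ih β hβ hv
    exact ⟨β', hβ'.trans hβ, hv⟩

theorem exists_transfiniteIterate_eq_self {φ : Set V → Set V} (hφ : ∀ X, X ⊆ φ X) :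
    ∃ θ : Ordinal.{u}, φ (transfiniteIterate φ θ ∅) = transfiniteIterate φ θ ∅ := by
  have hmono := monotone_transfiniteIterate (J := Ordinal.{u}) φ ∅ hφ
  obtain ⟨α, β, hlt, heq⟩ : ∃ α β : Ordinal.{u}, α < β ∧
      transfiniteIterate φ α ∅ = transfiniteIterate φ β ∅ := by
    have := not_injective_of_ordinal fun α : Ordinal.{u} => transfiniteIterate φ α (∅ : Set V)
    grind [Function.Injective]
  refine ⟨α, subset_antisymm ?_ (hφ _)⟩
  rw [← transfiniteIterate_succ φ _ _ (not_isMax α)]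
  exact (hmono (Order.succ_le_of_lt hlt)).trans heq.ge

theorem exists_rank_transfiniteIterate {φ : Set V → Set V} (hφ : ∀ X, X ⊆ φ X) (θ : Ordinal.{u}) :
    ∃ ρ : V → Ordinal.{u}, ∀ γ ≤ θ, ρ ⁻¹' Iio γ = transfiniteIterate φ γ ∅ := by
  refine ⟨fun v => sInf {β | θ ≤ β ∨ v ∈ transfiniteIterate φ (Order.succ β) ∅}, fun γ hγ => ?_⟩
  ext v
  rw [mem_preimage, mem_Iio, csInf_lt_iff (OrderBot.bddBelow _) ⟨θ, Or.inl le_rfl⟩,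
    mem_transfiniteIterate_empty_iff hφ]
  constructor
  · rintro ⟨β, hβ | hv, hlt⟩
    · exact absurd (hlt.trans_le hγ) hβ.not_gt
    · exact ⟨β, hlt, hv⟩
  · rintro ⟨β, hlt, hv⟩
    exact ⟨β, Or.inr hv, hlt⟩

theorem exists_maximal_layering (P : Set V → Set V → Prop) :
    ∃ (ρ : V → Ordinal.{u}) (θ : Ordinal.{u}),
      (∀ v, ρ v < θ → P (ρ ⁻¹' Iio (ρ v)) (ρ ⁻¹' {ρ v})) ∧
      ∀ D : Set V, D.Nonempty → Disjoint (ρ ⁻¹' Iio θ) D → ¬ P (ρ ⁻¹' Iio θ) D := by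
  have hextend : ∀ X : Set V, ∃ D, Disjoint X D ∧ (D.Nonempty → P X D) ∧
      (D = ∅ → ∀ D' : Set V, D'.Nonempty → Disjoint X D' → ¬ P X D') := by
    intro X
    by_cases h : ∃ D : Set V, D.Nonempty ∧ Disjoint X D ∧ P X D
    · obtain ⟨D, hne, hdisj, hP⟩ := h
      exact ⟨D, hdisj, fun _ => hP, fun hD => absurd hD hne.ne_empty⟩
    · exact ⟨∅, disjoint_empty X, fun h => absurd h not_nonempty_empty,
        fun _ D' hne hdisj hP => h ⟨D', hne, hdisj, hP⟩⟩
  choose g hdisj hP hmax using hextend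
  have hφ : ∀ X, X ⊆ X ∪ g X := fun _ => subset_union_left
  obtain ⟨θ, hθ⟩ := exists_transfiniteIterate_eq_self hφ
  obtain ⟨ρ, hρ⟩ := exists_rank_transfiniteIterate hφ θ
  refine ⟨ρ, θ, fun v hv => ?_, ?_⟩
  · have hlayer : ρ ⁻¹' {ρ v} = g (ρ ⁻¹' Iio (ρ v)) := by
      have hsucc := hρ _ (Order.succ_le_of_lt hv)
      rw [transfiniteIterate_succ _ _ _ (not_isMax _), ← hρ _ hv.le, Order.Iio_succ] at hsucc
      rw [← Iic_sdiff_Iio_same, preimage_sdiff, hsucc, union_sdiff_cancel_left]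
      exact (hdisj _).inter_eq.subset
    rw [hlayer]
    exact hP _ (hlayer ▸ ⟨v, rfl⟩)
  · have hempty : g (ρ ⁻¹' Iio θ) = ∅ := by
      rw [← hρ θ le_rfl] at hθ
      exact (hdisj _).eq_bot_of_ge (union_eq_left.1 hθ)
    exact hmax _ hempty

/-! ### Finitary conditions as bounded response -/

/-- The plays that, for some `N`, from the `N`-th vertex on follow every visit to a vertex `v` by a
visit to `T v` within `N` steps. -/
def BoundedResponse (T : V → Set V) : Set (ℕ → V) :=
  {π | ∃ N, ∀ k ≥ N, ∃ j ≤ N, π (k + j) ∈ T (π k)}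

theorem iInf_dist_le_iff {p : ℕ → Prop} {k N : ℕ} :
    ⨅ (k' : ℕ) (_ : k ≤ k' ∧ p k'), ((k' - k : ℕ) : ℕ∞) ≤ N ↔ ∃ j ≤ N, p (k + j) := by
  constructor
  · intro h
    by_contra! hN
    have hfar : ((N + 1 : ℕ) : ℕ∞) ≤ N := by
      refine (le_iInf₂ fun k' hk' => Nat.cast_le.2 ?_).trans h
      by_contra! hlt
      exact hN (k' - k) (Nat.le_of_lt_succ hlt) ((Nat.add_sub_cancel' hk'.1).symm ▸ hk'.2)
    exact N.not_succ_le_self (Nat.cast_le.1 hfar)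
  · rintro ⟨j, hj, hp⟩
    exact (iInf₂_le (k + j) ⟨k.le_add_right j, hp⟩).trans (by simpa using hj)

theorem limsup_lt_top_iff {f : ℕ → ℕ∞} :
    Filter.limsup f Filter.atTop < ⊤ ↔ ∃ N : ℕ, ∀ k ≥ N, f k ≤ N := by
  constructor
  · intro h
    obtain ⟨b, hb⟩ := ENat.ne_top_iff_exists.1 h.ne
    have hlt : Filter.limsup f Filter.atTop < (b + 1 : ℕ) :=
      hb ▸ Nat.cast_lt.2 b.lt_succ_self
    obtain ⟨K, hK⟩ := Filter.eventually_atTop.1 (Filter.eventually_lt_of_limsup_lt hlt)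
    exact ⟨max (b + 1) K, fun k hk => (hK k (le_of_max_le_right hk)).le.trans
      (Nat.cast_le.2 (le_max_left _ _))⟩
  · rintro ⟨N, hN⟩
    exact (Filter.limsup_le_of_le (by isBoundedDefault)
      (Filter.eventually_atTop.2 ⟨N, hN⟩)).trans_lt (ENat.natCast_lt_top N)

theorem finBuchi_eq_boundedResponse (F : Set V) : FinBuchi F = BoundedResponse fun _ => F := by
  ext π
  simp only [FinBuchi, distBuchi, BoundedResponse, mem_ofPred_eq, limsup_lt_top_iff,
    iInf_dist_le_iff]

theorem finParity_eq_boundedResponse {d : ℕ} (c : V → Fin (d + 1)) :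
    FinParity c = BoundedResponse fun v => {u | Even (c u : ℕ) ∧ c u ≤ c v} := by
  ext π
  simp only [FinParity, distParity, BoundedResponse, mem_ofPred_eq, limsup_lt_top_iff,
    iInf_dist_le_iff]

open Classical in
theorem finBuchi_eq_finParity (F : Set V) :
    FinBuchi F = FinParity (d := 1) fun v => if v ∈ F then 0 else 1 := by
  rw [finBuchi_eq_boundedResponse, finParity_eq_boundedResponse]
  congr! 2 with v
  ext u
  by_cases hu : u ∈ F <;> simp [hu]

/-! ### Eve's winning set -/

theorem exists_guided_move (A : Arena V) (S : Set V) (x v : V) :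
    ∃ u, A.Edge v u ∧ (A.Edge v x → x ∈ S → u = x) ∧ ((∃ y, A.Edge v y ∧ y ∈ S) → u ∈ S) := by
  by_cases hx : A.Edge v x ∧ x ∈ S
  · exact ⟨x, hx.1, fun _ _ => rfl, fun _ => hx.2⟩
  by_cases hy : ∃ y, A.Edge v y ∧ y ∈ S
  · obtain ⟨y, hvy, hyS⟩ := hy
    exact ⟨y, hvy, fun h h' => absurd ⟨h, h'⟩ hx, fun _ => hyS⟩
  · obtain ⟨y, hvy⟩ := A.no_dead_end v
    exact ⟨y, hvy, fun h h' => absurd ⟨h, h'⟩ hx, fun h => absurd h hy⟩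

/-- Adam's strategy that moves to `p n` in the `n`-th step, or, if this is not a legal move into
`S`, to any vertex of `S` if possible. Letting `p` vary, these strategies realise all the plays in
which Adam always moves into `S`. -/
noncomputable def guidedAdam (A : Arena V) (S : Set V) (p : ℕ → V) : AdamStrategy A where
  move w v := (exists_guided_move A S (p w.length) v).choose
  legal w v := (exists_guided_move A S (p w.length) v).choose_spec.1

theorem guidedAdam_move_eq {A : Arena V} {S : Set V} {p : ℕ → V} {w : List V} {v : A.adam}
    (hedge : A.Edge v (p w.length)) (hmem : p w.length ∈ S) :
    (guidedAdam A S p).move w v = p w.length :=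
  (exists_guided_move A S (p w.length) v).choose_spec.2.1 hedge hmem

theorem guidedAdam_move_mem {A : Arena V} {S : Set V} {p : ℕ → V} {w : List V} {v : A.adam}
    (h : ∃ u, A.Edge v u ∧ u ∈ S) : (guidedAdam A S p).move w v ∈ S :=
  (exists_guided_move A S (p w.length) v).choose_spec.2.2 h

section Play

variable {A : Arena V} {σ : EveStrategy A} {v₀ : V}

theorem length_past (τ : AdamStrategy A) (n : ℕ) : (position v₀ σ τ n).1.length = n := by
  induction n with
  | zero => rfl
  | succ n ih => simp [position, ih]

theorem play_succ_of_mem_eve {τ : AdamStrategy A} {n : ℕ} (h : play v₀ σ τ n ∈ A.eve) :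
    play v₀ σ τ (n + 1) = σ.move (position v₀ σ τ n).1 ⟨play v₀ σ τ n, h⟩ :=
  dif_pos h

theorem play_succ_of_mem_adam {τ : AdamStrategy A} {n : ℕ} (h : play v₀ σ τ n ∈ A.adam) :
    play v₀ σ τ (n + 1) = τ.move (position v₀ σ τ n).1 ⟨play v₀ σ τ n, h⟩ :=
  dif_neg h

theorem edge_play (τ : AdamStrategy A) (n : ℕ) :
    A.Edge (play v₀ σ τ n) (play v₀ σ τ (n + 1)) := by
  by_cases h : play v₀ σ τ n ∈ A.eve
  · rw [play_succ_of_mem_eve h]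
    exact σ.legal _ ⟨_, h⟩
  · rw [play_succ_of_mem_adam h]
    exact τ.legal _ ⟨_, h⟩

end Play

open PiNat (cylinder)

section Guided

variable {A : Arena V} {S X : Set V} {T : V → Set V} {σ : EveStrategy A} {v₀ : V} {p q : ℕ → V}

theorem position_guidedAdam_congr {n : ℕ} (hq : q ∈ cylinder p n) :
    position v₀ σ (guidedAdam A S q) n = position v₀ σ (guidedAdam A S p) n := by
  induction n with
  | zero => rfl
  | succ n ih =>
    have hnext : ∀ w v, w.length = n →
        next σ (guidedAdam A S q) w v = next σ (guidedAdam A S p) w v := by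
      rintro w v rfl
      simp only [next, guidedAdam, hq _ (Nat.lt_succ_self _)]
    simp only [position, ih (PiNat.cylinder_anti p n.le_succ hq), hnext _ _ (length_past _ n)]

theorem play_guidedAdam_congr {n : ℕ} (hq : q ∈ cylinder p n) :
    play v₀ σ (guidedAdam A S q) n = play v₀ σ (guidedAdam A S p) n :=
  congrArg Prod.snd (position_guidedAdam_congr hq)

theorem continuous_play_guidedAdam [TopologicalSpace V] [DiscreteTopology V] :
    Continuous fun p : ℕ → V => play v₀ σ (guidedAdam A S p) := by
  refine continuous_pi fun n => IsLocallyConstant.continuous ?_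
  exact (IsLocallyConstant.iff_exists_open _).2 fun p =>
    ⟨cylinder p n, PiNat.isOpen_cylinder _ p n, PiNat.self_mem_cylinder p n,
      fun _ hq => play_guidedAdam_congr hq⟩

theorem play_guidedAdam_notMem (hX : A.cpre X ⊆ X) (hv₀ : v₀ ∉ X) (n : ℕ) :
    play v₀ σ (guidedAdam A Xᶜ p) n ∉ X := by
  induction n with
  | zero => exact hv₀
  | succ n ih =>
    set v := play v₀ σ (guidedAdam A Xᶜ p) n
    by_cases he : v ∈ A.eve
    · exact fun hu => ih (hX ⟨fun _ => ⟨_, edge_play _ n, hu⟩, fun ha => absurd he ha⟩)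
    · have hout : ∃ u, A.Edge v u ∧ u ∈ Xᶜ := by
        by_contra! hcon
        exact ih (hX ⟨fun h => absurd h he, fun _ u hu => not_not.1 (hcon u hu)⟩)
      rw [play_succ_of_mem_adam he]
      exact guidedAdam_move_mem (v := ⟨v, he⟩) hout

theorem exists_play_notMem_of_notMem_cpre (hXS : X ⊆ S) {k : ℕ}
    (hk : play v₀ σ (guidedAdam A Xᶜ p) k ∉ A.cpre S) :
    ∃ q ∈ cylinder p k, play v₀ σ (guidedAdam A Xᶜ q) (k + 1) ∉ S := by
  by_cases he : play v₀ σ (guidedAdam A Xᶜ p) k ∈ A.eve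
  · exact ⟨p, PiNat.self_mem_cylinder p k, fun hu =>
      hk ⟨fun _ => ⟨_, edge_play _ k, hu⟩, fun ha => absurd he ha⟩⟩
  · obtain ⟨u, hvu, huS⟩ : ∃ u, A.Edge (play v₀ σ (guidedAdam A Xᶜ p) k) u ∧ u ∉ S := by
      by_contra! hcon
      exact hk ⟨fun h => absurd h he, fun _ => hcon⟩
    have hq : Function.update p k u ∈ cylinder p k := PiNat.update_mem_cylinder p k u
    refine ⟨_, hq, ?_⟩
    have hv := play_guidedAdam_congr (A := A) (S := Xᶜ) (σ := σ) (v₀ := v₀) hq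
    rw [← hv] at he hvu
    have hguide : Function.update p k u
        (position v₀ σ (guidedAdam A Xᶜ (Function.update p k u)) k).1.length = u := by
      rw [length_past, Function.update_self]
    rw [play_succ_of_mem_adam he, guidedAdam_move_eq, hguide]
    · exact huS
    · rwa [hguide]
    · rw [hguide]
      exact notMem_subset hXS huS

/-- Baire category: the guidances for which the bound is `N` form a closed set, and these sets cover
the space of all guidances. -/
theorem exists_cylinder_response_le
    (hσ : EveStrategy.WinsFrom σ (BoundedResponse T) {v₀}) (S : Set V) :
    ∃ p N, ∀ q ∈ cylinder p N, ∀ k ≥ N, ∃ j ≤ N,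
      play v₀ σ (guidedAdam A S q) (k + j) ∈ T (play v₀ σ (guidedAdam A S q) k) := by
  let _ : TopologicalSpace V := ⊥
  have : DiscreteTopology V := ⟨rfl⟩
  have : Nonempty V := ⟨v₀⟩
  let Z (N : ℕ) : Set (ℕ → V) := {π | ∀ k ≥ N, ∃ j ≤ N, π (k + j) ∈ T (π k)}
  have hZclosed (N : ℕ) : IsClosed (Z N) := by
    have hclosed (k j : ℕ) : IsClosed {π : ℕ → V | π (k + j) ∈ T (π k)} :=
      (isClosed_discrete {x : V × V | x.2 ∈ T x.1}).preimage
        (f := fun π : ℕ → V => (π k, π (k + j))) (by fun_prop)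
    simp only [Z, ofPred_forall]
    refine isClosed_iInter fun k => isClosed_iInter fun _ => ?_
    convert (finite_Iic N).isClosed_biUnion fun j _ => hclosed k j
    ext π
    simp
  let Y (N : ℕ) : Set (ℕ → V) := (fun p => play v₀ σ (guidedAdam A S p)) ⁻¹' Z N
  have hYclosed (N : ℕ) : IsClosed (Y N) := (hZclosed N).preimage continuous_play_guidedAdam
  have hYcover : ⋃ N, Y N = univ := eq_univ_of_forall fun p => mem_iUnion.2 (hσ v₀ rfl _)
  obtain ⟨N, p, hp⟩ := nonempty_interior_of_iUnion_of_closed hYclosed hYcover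
  obtain ⟨_, ⟨q, m, rfl⟩, -, hqN⟩ :=
    (PiNat.isTopologicalBasis_cylinders fun _ => V).mem_nhds_iff.1 (mem_interior_iff_mem_nhds.1 hp)
  refine ⟨q, max m N, fun r hr k hk => ?_⟩
  obtain ⟨j, hj, h⟩ := hqN (PiNat.cylinder_anti q (le_max_left m N) hr) k (le_of_max_le_right hk)
  exact ⟨j, hj.trans (le_max_right m N), h⟩

theorem exists_play_avoiding_of_notMem_attr {D G : Set V} (n : ℕ) {k : ℕ}
    (hD : ∀ q ∈ cylinder p k, ∀ j, play v₀ σ (guidedAdam A Xᶜ q) (k + j) ∈ D)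
    (hk : play v₀ σ (guidedAdam A Xᶜ p) k ∉ A.attr X D G n) :
    ∃ q ∈ cylinder p k, ∀ j ≤ n, play v₀ σ (guidedAdam A Xᶜ q) (k + j) ∉ G := by
  induction n generalizing p k with
  | zero =>
    refine ⟨p, PiNat.self_mem_cylinder p k, fun j hj => ?_⟩
    rw [Nat.le_zero.1 hj]
    exact hk
  | succ n ih =>
    obtain ⟨hkG, hkpre⟩ := not_or.1 hk
    obtain ⟨q, hq, hqS⟩ := exists_play_notMem_of_notMem_cpre subset_union_left hkpre
    have hqattr : play v₀ σ (guidedAdam A Xᶜ q) (k + 1) ∉ A.attr X D G n :=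
      fun h => hqS (Or.inr ⟨hD q hq 1, h⟩)
    have hqp : cylinder q (k + 1) ⊆ cylinder p k :=
      (PiNat.cylinder_anti q k.le_succ).trans (PiNat.mem_cylinder_iff_eq.1 hq).subset
    obtain ⟨r, hr, hrG⟩ := ih (fun r hr j => add_assoc k 1 j ▸ hD r (hqp hr) (1 + j)) hqattr
    refine ⟨r, hqp hr, fun j hj => ?_⟩
    cases j with
    | zero => rwa [add_zero, play_guidedAdam_congr (hqp hr)]
    | succ j => simpa only [add_assoc, add_comm 1 j] using hrG j (Nat.le_of_succ_le_succ hj)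

/-- The vertices that are visited after the histories for which the response time is uniform would
form a layer. -/
theorem eveWinningSet_subset_of_forall_not_isLayer
    (hX : ∀ D : Set V, D.Nonempty → Disjoint X D → ¬ IsLayer A T X D) :
    eveWinningSet A (BoundedResponse T) ⊆ X := by
  rintro v₀ ⟨σ, hσ⟩
  by_contra hv₀
  have hcpre : A.cpre X ⊆ X := fun v hv => by
    by_contra hvX
    exact hX {v} (singleton_nonempty v) (disjoint_singleton_right.2 hvX) (isLayer_singleton hv)
  obtain ⟨p, N, hN⟩ := exists_cylinder_response_le hσ Xᶜ
  let D : Set V := {v | ∃ q ∈ cylinder p N, ∃ k ≥ N, play v₀ σ (guidedAdam A Xᶜ q) k = v}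
  have hD : ∀ q ∈ cylinder p N, ∀ k ≥ N, ∀ r ∈ cylinder q k, ∀ j,
      r ∈ cylinder p N ∧ play v₀ σ (guidedAdam A Xᶜ r) (k + j) ∈ D := by
    intro q hq k hk r hr j
    have hrp : r ∈ cylinder p N := PiNat.mem_cylinder_iff_eq.1 hq ▸ PiNat.cylinder_anti q hk hr
    exact ⟨hrp, r, hrp, k + j, by omega, rfl⟩
  refine hX D ⟨_, p, PiNat.self_mem_cylinder p N, N, le_rfl, rfl⟩ ?_ ⟨?_, N, ?_⟩
  · rw [disjoint_right]
    rintro _ ⟨q, -, k, -, rfl⟩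
    exact play_guidedAdam_notMem hcpre hv₀ k
  · rintro _ ⟨q, hq, k, hk, rfl⟩
    by_contra hpre
    obtain ⟨r, hr, hout⟩ := exists_play_notMem_of_notMem_cpre subset_union_left hpre
    exact hout (Or.inr (hD q hq k hk r hr 1).2)
  · rintro _ ⟨q, hq, k, hk, rfl⟩
    by_contra hattr
    obtain ⟨r, hr, hav⟩ := exists_play_avoiding_of_notMem_attr N
      (fun r hr j => (hD q hq k hk r hr j).2) hattr
    obtain ⟨j, hj, hans⟩ := hN r (hD q hq k hk r hr 0).1 k hk
    rw [play_guidedAdam_congr hr] at hans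
    exact hav j hj hans

end Guided

/-! ### Answering the smallest open request -/

/-- The vertices that answer the request `i`. -/
def answers {d : ℕ} (c : V → Fin (d + 1)) (i : ℕ∞) : Set V :=
  {u | Even (c u : ℕ) ∧ ((c u : ℕ) : ℕ∞) ≤ i}

/-- The smallest open request after a visit to a vertex of colour `a`, where `m` is the smallest
request that was open before. Odd colours are requests, and `⊤` stands for the absence of open
requests. -/
noncomputable def openRequest (m : ℕ∞) (a : ℕ) : ℕ∞ :=
  if Even a then if (a : ℕ∞) ≤ m then ⊤ else m else min m a

/-- The values of the smallest open request for the colours `0, …, d`. -/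
noncomputable def requestStates (d : ℕ) : Finset ℕ∞ :=
  insert ⊤ (((Finset.range (d + 1)).filter fun i => Odd i).image (↑))

theorem answers_mono {d : ℕ} (c : V → Fin (d + 1)) : Monotone (answers c) :=
  fun _ _ h _ hu => ⟨hu.1, hu.2.trans h⟩

theorem finParity_eq_boundedResponse_answers {d : ℕ} (c : V → Fin (d + 1)) :
    FinParity c = BoundedResponse fun v => answers c (c v : ℕ) := by
  simp only [finParity_eq_boundedResponse, answers, Nat.cast_le, Fin.val_fin_le]

theorem openRequest_cases (m : ℕ∞) (a : ℕ) :
    openRequest m a = ⊤ ∨ openRequest m a = m ∨ Odd a ∧ openRequest m a = a := by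
  grind [openRequest]

theorem openRequest_le {m : ℕ∞} {a : ℕ} (h : ¬ (Even a ∧ (a : ℕ∞) ≤ m)) : openRequest m a ≤ m := by
  grind [openRequest]

theorem openRequest_le_of_odd (m : ℕ∞) {a : ℕ} (ha : ¬ Even a) : openRequest m a ≤ a := by
  grind [openRequest]

theorem not_even_and_le_openRequest {m : ℕ∞} {a : ℕ} (h : openRequest m a ≠ ⊤) :
    ¬ (Even a ∧ (a : ℕ∞) ≤ openRequest m a) := by
  grind [openRequest]

theorem top_mem_requestStates (d : ℕ) : ⊤ ∈ requestStates d := Finset.mem_insert_self _ _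

theorem openRequest_mem_requestStates {d a : ℕ} {m : ℕ∞} (hm : m ∈ requestStates d) (ha : a ≤ d) :
    openRequest m a ∈ requestStates d := by
  obtain h | h | ⟨hodd, h⟩ := openRequest_cases m a
  · simp [h, requestStates]
  · rwa [h]
  · rw [h]
    refine Finset.mem_insert_of_mem (Finset.mem_image_of_mem _ ?_)
    simpa [Nat.lt_succ_iff] using ⟨ha, hodd⟩

theorem card_requestStates_le (d : ℕ) : (requestStates d).card ≤ numOddColours d + 1 :=
  (Finset.card_insert_le _ _).trans (Nat.add_le_add_right Finset.card_image_le 1)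

theorem openRequest_of_mem_requestStates_one {m : ℕ∞} (hm : m ∈ requestStates 1) (a : Fin 2) :
    openRequest m a = if a = 0 then ⊤ else 1 := by
  have hm : m = ⊤ ∨ m = 1 := by
    have hfilter : ((Finset.range 2).filter fun i => Odd i) = {1} := by decide
    simpa [requestStates, hfilter] using hm
  fin_cases a <;> rcases hm with rfl | rfl <;> simp [openRequest]

section Response

variable {A : Arena V} {X D : Set V} {d N : ℕ} {c : V → Fin (d + 1)} {π : ℕ → V} {e : ℕ → ℕ∞}

theorem mem_attr_openRequest (hX : ∀ n, π n ∉ X)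
    (hN : ∀ n, π n ∈ A.attr X D (answers c (c (π n) : ℕ)) N)
    (h0 : e 0 = openRequest ⊤ (c (π 0)))
    (hsucc : ∀ n, e (n + 1) = openRequest (e n) (c (π (n + 1))))
    (hadv : ∀ n, A.Advances X D (answers c (e n)) (π n) (π (n + 1)))
    (n : ℕ) (hn : e n ≠ ⊤) : π n ∈ A.attr X D (answers c (e n)) N := by
  have hopen (m : ℕ) : e m ≠ ⊤ → π m ∉ answers c (e m) := by
    cases m with
    | zero => exact h0 ▸ not_even_and_le_openRequest
    | succ m => exact hsucc m ▸ not_even_and_le_openRequest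
  induction n with
  | zero =>
    rw [h0] at hn ⊢
    obtain h | h | ⟨-, h⟩ := openRequest_cases ⊤ (c (π 0))
    · exact absurd h hn
    · exact absurd h hn
    · exact h ▸ hN 0
  | succ n ih =>
    rw [hsucc] at hn ⊢
    obtain h | h | ⟨-, h⟩ := openRequest_cases (e n) (c (π (n + 1)))
    · exact absurd h hn
    · rw [h] at hn ⊢
      exact ((hadv n).2 (hopen n hn) N (attr_mono N.le_succ (ih hn))).resolve_left
        (hX _)
    · exact h ▸ hN (n + 1)

/-- A smaller request that is opened in the meantime restarts the countdown of `N` steps, which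
happens at most `i` times. -/
theorem exists_mem_answers_of_mem_attr (hX : ∀ n, π n ∉ X)
    (hN : ∀ n, e n ≠ ⊤ → π n ∈ A.attr X D (answers c (e n)) N)
    (hsucc : ∀ n, e (n + 1) = openRequest (e n) (c (π (n + 1))))
    (hadv : ∀ n, A.Advances X D (answers c (e n)) (π n) (π (n + 1)))
    {b n i k : ℕ} (hi : e n = i) (hk : π n ∈ A.attr X D (answers c i) k) (hb : k + i * N ≤ b) :
    ∃ j ≤ b, π (n + j) ∈ answers c i := by
  induction b generalizing n i k with
  | zero =>
    obtain rfl : k = 0 := by omega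
    exact ⟨0, le_rfl, hk⟩
  | succ b ih =>
    by_cases hnow : π n ∈ answers c i
    · exact ⟨0, Nat.zero_le _, hnow⟩
    obtain _ | k := k
    · exact absurd hk hnow
    have hnext : π (n + 1) ∈ A.attr X D (answers c i) k :=
      ((hi ▸ (hadv n).2) hnow k hk).resolve_left (hX _)
    by_cases hans : π (n + 1) ∈ answers c i
    · exact ⟨1, Nat.le_add_left _ _, hans⟩
    suffices h : ∃ j ≤ b, π (n + 1 + j) ∈ answers c i by
      obtain ⟨j, hj, h⟩ := h
      exact ⟨j + 1, Nat.succ_le_succ hj, by rwa [add_comm j, ← add_assoc]⟩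
    have hle : e (n + 1) ≤ i := by
      rw [hsucc, hi]
      exact openRequest_le hans
    obtain ⟨i', hi'⟩ := ENat.ne_top_iff_exists.1 (ne_top_of_le_ne_top (ENat.natCast_ne_top i) hle)
    have hle' : i' ≤ i := Nat.cast_le.1 (hi' ▸ hle)
    obtain rfl | hlt := hle'.eq_or_lt
    · exact ih hi'.symm hnext (by omega)
    · have hfresh : π (n + 1) ∈ A.attr X D (answers c i') N := by
        rw [hi']
        exact hN _ (hi' ▸ ENat.natCast_ne_top i')
      obtain ⟨j, hj, h⟩ := ih hi'.symm hfresh (by nlinarith)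
      exact ⟨j, hj, answers_mono c (Nat.cast_le.2 hle') h⟩

theorem exists_response_le_of_advances (hX : ∀ n, π n ∉ X)
    (hN : ∀ n, π n ∈ A.attr X D (answers c (c (π n) : ℕ)) N)
    (h0 : e 0 = openRequest ⊤ (c (π 0)))
    (hsucc : ∀ n, e (n + 1) = openRequest (e n) (c (π (n + 1))))
    (hadv : ∀ n, A.Advances X D (answers c (e n)) (π n) (π (n + 1))) (n : ℕ) :
    ∃ j ≤ N + d * N, π (n + j) ∈ answers c (c (π n) : ℕ) := by
  by_cases heven : Even (c (π n) : ℕ)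
  · exact ⟨0, Nat.zero_le _, heven, le_rfl⟩
  have hle : e n ≤ (c (π n) : ℕ) := by
    cases n with
    | zero => exact h0 ▸ openRequest_le_of_odd _ heven
    | succ n => exact hsucc n ▸ openRequest_le_of_odd _ heven
  have hattr := mem_attr_openRequest hX hN h0 hsucc hadv
  obtain ⟨i, hi⟩ := ENat.ne_top_iff_exists.1 (ne_top_of_le_ne_top (ENat.natCast_ne_top _) hle)
  have hid : i ≤ d := (Nat.cast_le.1 (hi ▸ hle)).trans (Nat.le_of_lt_succ (c (π n)).2)
  have hi_attr : π n ∈ A.attr X D (answers c i) N := hi ▸ hattr n (hi ▸ ENat.natCast_ne_top i)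
  obtain ⟨j, hj, hans⟩ := exists_mem_answers_of_mem_attr hX hattr hsucc hadv hi.symm hi_attr
    (Nat.add_le_add_left (Nat.mul_le_mul_right N hid) N)
  exact ⟨j, hj, answers_mono c (hi ▸ hle) hans⟩

end Response

/-! ### Strategies on layers -/

theorem exists_forall_ge_eq_of_antitone {ι : Type*} [LinearOrder ι] [WellFoundedLT ι] {f : ℕ → ι}
    (hf : Antitone f) : ∃ K, (∀ n ≥ K, f n = f K) ∧ ∀ n, n + 1 = K → f K ≠ f n := by
  classical
  have hex : ∃ K, ∀ n ≥ K, f n = f K := by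
    obtain ⟨K, hK⟩ := WellFoundedLT.antitone_chain_condition hf
    exact ⟨K, fun n hn => (hK n hn).symm⟩
  refine ⟨Nat.find hex, Nat.find_spec hex, fun n hn heq => ?_⟩
  refine Nat.find_min hex (Nat.lt_of_succ_le hn.le) fun m hm => ?_
  obtain rfl | hlt := hm.eq_or_lt
  · rfl
  · exact (Nat.find_spec hex m (hn.ge.trans hlt)).trans heq

/-- The memory structure that stores the smallest request that was opened since the last change of
rank and is still open before the visit to the current vertex. -/
noncomputable def requestMemory {ι : Type*} [DecidableEq ι] (ρ : V → ι) {d : ℕ}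
    (c : V → Fin (d + 1)) : MemoryStructure V (requestStates d) where
  init := ⟨⊤, top_mem_requestStates d⟩
  update m u v :=
    if ρ v = ρ u then
      ⟨openRequest m (c u), openRequest_mem_requestStates m.2 (Nat.le_of_lt_succ (c u).2)⟩
    else ⟨⊤, top_mem_requestStates d⟩

theorem coe_requestMemory_update {ι : Type*} [DecidableEq ι] (ρ : V → ι) {d : ℕ}
    (c : V → Fin (d + 1)) (m : requestStates d) (u v : V) :
    ((requestMemory ρ c).update m u v : ℕ∞) = if ρ v = ρ u then openRequest m (c u) else ⊤ :=
  apply_ite Subtype.val (ρ v = ρ u) _ _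

/-- The smallest request that is open after the past `w` and a visit to `v`, among those opened
since the last change of rank. -/
noncomputable def smallestRequest {ι : Type*} [DecidableEq ι] (ρ : V → ι) {d : ℕ}
    (c : V → Fin (d + 1)) (w : List V) (v : V) : ℕ∞ :=
  openRequest ((requestMemory ρ c).state w v) (c v)

/-- The move from `v` to `u` advances towards `T` when the layers are the sets of vertices of the
same rank, stacked in the order of the ranks. -/
def Arena.AdvancesInLayer {ι : Type*} [LinearOrder ι] (A : Arena V) (ρ : V → ι) (T : Set V)
    (v u : V) : Prop :=
  A.Advances (ρ ⁻¹' Iio (ρ v)) (ρ ⁻¹' {ρ v}) T v u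

section Layered

variable {A : Arena V} {ι : Type*} [LinearOrder ι] {ρ : V → ι} {θ : ι} {d : ℕ}
  {c : V → Fin (d + 1)}

theorem exists_advancing_strategy
    (hρ : ∀ v, ρ v < θ →
      IsLayer A (fun v => answers c (c v : ℕ)) (ρ ⁻¹' Iio (ρ v)) (ρ ⁻¹' {ρ v})) :
    ∃ (ν : A.eve → ℕ∞ → V) (σ : EveStrategy A),
      (∀ w v, σ.move w v = ν v (smallestRequest ρ c w v)) ∧
      ∀ v₀ τ n, ρ (play v₀ σ τ n) < θ →
        A.AdvancesInLayer ρ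
          (answers c (smallestRequest ρ c (position v₀ σ τ n).1 (play v₀ σ τ n)))
          (play v₀ σ τ n) (play v₀ σ τ (n + 1)) := by
  have hcpre (v : V) (hv : ρ v < θ) (i : ℕ∞) :
      v ∈ A.cpre {u | A.AdvancesInLayer ρ (answers c i) v u} := mem_cpre_advances ((hρ v hv).1 rfl)
  have hmove (v : A.eve) (i : ℕ∞) : ∃ u, A.Edge v u ∧
      (ρ v < θ → A.AdvancesInLayer ρ (answers c i) v u) := by
    by_cases hv : ρ v < θ
    · obtain ⟨u, hvu, hu⟩ := (hcpre v hv i).1 v.2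
      exact ⟨u, hvu, fun _ => hu⟩
    · exact (A.no_dead_end v).imp fun u hvu => ⟨hvu, fun h => absurd h hv⟩
  choose ν hedge hadv using hmove
  let σ : EveStrategy A :=
    ⟨fun w v => ν v (smallestRequest ρ c w v), fun _ _ => hedge _ _⟩
  refine ⟨ν, σ, fun _ _ => rfl, fun v₀ τ n hn => ?_⟩
  by_cases he : play v₀ σ τ n ∈ A.eve
  · rw [play_succ_of_mem_eve he]
    exact hadv ⟨_, he⟩ _ hn
  · exact (hcpre _ hn _).2 he _ (edge_play τ n)

theorem play_mem_finParity_of_advances [WellFoundedLT ι]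
    (hρ : ∀ v, ρ v < θ →
      IsLayer A (fun v => answers c (c v : ℕ)) (ρ ⁻¹' Iio (ρ v)) (ρ ⁻¹' {ρ v}))
    {σ : EveStrategy A} {τ : AdamStrategy A} {v₀ : V} (hv₀ : ρ v₀ < θ)
    (hadv : ∀ n, ρ (play v₀ σ τ n) < θ →
        A.AdvancesInLayer ρ
          (answers c (smallestRequest ρ c (position v₀ σ τ n).1 (play v₀ σ τ n)))
          (play v₀ σ τ n) (play v₀ σ τ (n + 1))) :
    play v₀ σ τ ∈ FinParity c := by
  set π := play v₀ σ τ
  let s (n : ℕ) := (requestMemory ρ c).state (position v₀ σ τ n).1 (π n)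
  have hs (n : ℕ) : s (n + 1) = (requestMemory ρ c).update (s n) (π n) (π (n + 1)) := rfl
  have hle (n : ℕ) (hn : ρ (π n) < θ) : ρ (π (n + 1)) ≤ ρ (π n) :=
    (hadv n hn).1.elim le_of_lt le_of_eq
  have hθ (n : ℕ) : ρ (π n) < θ := by
    induction n with
    | zero => exact hv₀
    | succ n ih => exact (hle n ih).trans_lt ih
  obtain ⟨K, hconst, hK⟩ := exists_forall_ge_eq_of_antitone
    (antitone_nat_of_succ_le (f := fun n => ρ (π n)) fun n => hle n (hθ n))
  have hsK : (s K : ℕ∞) = ⊤ := by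
    cases K with
    | zero => rfl
    | succ K => rw [hs, coe_requestMemory_update, if_neg (hK K rfl)]
  have hrank (n : ℕ) : ρ (π (K + n)) = ρ (π K) := hconst _ (K.le_add_right n)
  obtain ⟨N, hN⟩ := (hρ _ (hθ K)).2
  have hresp := exists_response_le_of_advances (A := A) (c := c) (N := N)
    (X := ρ ⁻¹' Iio (ρ (π K))) (D := ρ ⁻¹' {ρ (π K)}) (π := fun n => π (K + n))
    (e := fun n => openRequest (s (K + n)) (c (π (K + n))))
    (fun n hlt => hlt.ne (hrank n)) (fun n => hN _ (hrank n)) (by simp [hsK])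
    (fun n => by
      have : ρ (π (K + n + 1)) = ρ (π (K + n)) := (hrank (n + 1)).trans (hrank n).symm
      simp only [← add_assoc, hs, coe_requestMemory_update, if_pos this])
    (fun n => hrank n ▸ hadv (K + n) (hθ _))
  rw [finParity_eq_boundedResponse_answers]
  refine ⟨max K (N + d * N), fun k hk => ?_⟩
  obtain ⟨n, rfl⟩ := Nat.exists_eq_add_of_le (le_of_max_le_left hk)
  obtain ⟨j, hj, hans⟩ := hresp n
  exact ⟨j, le_max_of_le_right hj, by rwa [add_assoc]⟩

end Layered

theorem exists_strategy_openRequest (A : Arena V) {d : ℕ} (c : V → Fin (d + 1)) :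
    ∃ (𝓜 : MemoryStructure V (requestStates d)) (ν : A.eve → ℕ∞ → V) (σ : EveStrategy A),
      (∀ w v, σ.move w v = ν v (openRequest (𝓜.state w v) (c v))) ∧
      σ.WinsFrom (FinParity c) (eveWinningSet A (FinParity c)) := by
  obtain ⟨ρ, θ, hρ, hmax⟩ := exists_maximal_layering (IsLayer A fun v => answers c (c v : ℕ))
  obtain ⟨ν, σ, hmove, hadv⟩ := exists_advancing_strategy hρ
  refine ⟨requestMemory ρ c, ν, σ, hmove, fun v₀ hv₀ τ => ?_⟩
  have hv₀θ : ρ v₀ < θ := eveWinningSet_subset_of_forall_not_isLayer hmax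
    (finParity_eq_boundedResponse_answers c ▸ hv₀)
  exact play_mem_finParity_of_advances hρ hv₀θ fun n => hadv v₀ τ n

theorem exists_memoryless_winsFrom_finBuchi (A : Arena V) (F : Set V) :
    ∃ σ : EveStrategy A, σ.Memoryless ∧ σ.WinsFrom (FinBuchi F) (eveWinningSet A (FinBuchi F)) := by
  classical
  rw [finBuchi_eq_finParity]
  obtain ⟨𝓜, ν, σ, hmove, hwin⟩ :=
    exists_strategy_openRequest A (d := 1) fun v => if v ∈ F then 0 else 1
  refine ⟨σ, ⟨fun v => ν v (if (v : V) ∈ F then ⊤ else 1), fun w v => ?_⟩, hwin⟩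
  rw [hmove, openRequest_of_mem_requestStates_one (𝓜.state w v).2]
  split_ifs <;> simp_all

theorem exists_uses_memory_winsFrom_finParity (A : Arena V) {d : ℕ} (c : V → Fin (d + 1)) :
    ∃ (𝓜 : MemoryStructure V (requestStates d)) (σ : EveStrategy A),
      σ.Uses 𝓜 ∧ σ.WinsFrom (FinParity c) (eveWinningSet A (FinParity c)) := by
  obtain ⟨𝓜, ν, σ, hmove, hwin⟩ := exists_strategy_openRequest A c
  exact ⟨𝓜, σ, ⟨fun v m => ν v (openRequest m (c v)), hmove⟩, hwin⟩

end FinitaryGames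

theorem mainTheorem1_general {V : Type*} (A : FinitaryGames.Arena V) :
    (∀ F : Set V, ∃ σ : FinitaryGames.EveStrategy A,
      FinitaryGames.EveStrategy.Memoryless σ ∧
      FinitaryGames.EveStrategy.WinsFrom σ (FinitaryGames.FinBuchi F)
        (FinitaryGames.eveWinningSet A (FinitaryGames.FinBuchi F))) ∧
    (∀ (d : ℕ) (c : V → Fin (d + 1)),
      ∃ (M : Type) (_ : Finite M) (𝓜 : FinitaryGames.MemoryStructure V M)
        (σ : FinitaryGames.EveStrategy A),
        Nat.card M ≤ FinitaryGames.numOddColours d + 1 ∧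
        FinitaryGames.EveStrategy.Uses σ 𝓜 ∧
        FinitaryGames.EveStrategy.WinsFrom σ (FinitaryGames.FinParity c)
          (FinitaryGames.eveWinningSet A (FinitaryGames.FinParity c))) := by
  refine ⟨FinitaryGames.exists_memoryless_winsFrom_finBuchi A, fun d c => ?_⟩
  obtain ⟨𝓜, σ, huses, hwin⟩ := FinitaryGames.exists_uses_memory_winsFrom_finParity A c
  refine ⟨FinitaryGames.requestStates d, inferInstance, 𝓜, σ, ?_, huses, hwin⟩
  rw [Nat.card_eq_fintype_card, Fintype.card_coe]
  exact FinitaryGames.card_requestStates_le d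

theorem mainTheorem1 {V : Type*} [Countable V] (A : FinitaryGames.Arena V) :
    (∀ F : Set V, ∃ σ : FinitaryGames.EveStrategy A,
      FinitaryGames.EveStrategy.Memoryless σ ∧
      FinitaryGames.EveStrategy.WinsFrom σ (FinitaryGames.FinBuchi F)
        (FinitaryGames.eveWinningSet A (FinitaryGames.FinBuchi F))) ∧
    (∀ (d : ℕ) (c : V → Fin (d + 1)),
      ∃ (M : Type) (_ : Finite M) (𝓜 : FinitaryGames.MemoryStructure V M)
        (σ : FinitaryGames.EveStrategy A),
        Nat.card M ≤ FinitaryGames.numOddColours d + 1 ∧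
        FinitaryGames.EveStrategy.Uses σ 𝓜 ∧
        FinitaryGames.EveStrategy.WinsFrom σ (FinitaryGames.FinParity c)
          (FinitaryGames.eveWinningSet A (FinitaryGames.FinParity c))) :=
  mainTheorem1_general A
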